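/- Let $\mathcal H_A,\mathcal H_B,\mathcal H_C$ be finite-dimensional complex Hilbert spaces and let $\rho_{ABC}$ be a density matrix (positive semidefinite, trace one) on $\mathcal H_A\otimes\mathcal H_B\otimes\mathcal H_C$. For a subsystem $X\in\{B,AB,BC,ABC\}$ let $\rho_X=\mathrm{Tr}_{X^c}\,\rho_{ABC}$ be the reduced density matrix, and let $$\hat H_X=-\,I_{X^c}\otimes\log\rho_X ,$$ where $X^c$ denotes the complementary subsystem, and where the logarithm of a singular positive semidefinite matrix is taken on its support and set to zero on its kernel. Then the operator $$T_C=\mathrm{Tr}_{AB}\bigl(\rho_{ABC}(\hat H_{AB}+\hat H_{BC}-\hat H_B-\hat H_{ABC})\bigr)$$ on $\mathcal H_C$ is positive semidefinite (in particular Hermitian). Moreover, with the von Neumann entropy $S(\rho)=-\mathrm{Tr}(\rho\log\rho)$, $$\mathrm{Tr}\,T_C=S(\rho_{AB})+S(\rho_{BC})-S(\rho_B)-S(\rho_{ABC}),$$ so that positivity of $T_C$ yields strong subadditivity, $S(\rho_B)+S(\rho_{ABC})\le S(\rho_{AB})+S(\rho_{BC})$. -/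

import Mathlib

open scoped ComplexOrder Kronecker

namespace OperatorSSA

/-- A density matrix on the finite-dimensional Hilbert space with orthonormal basis indexed by `X`:
a positive semidefinite complex matrix of trace one. -/
structure IsDensityMatrix {X : Type*} [Fintype X] (ρ : Matrix X X ℂ) : Prop where
  posSemidef : ρ.PosSemidef
  trace_eq_one : ρ.trace = 1

/-- The partial trace over the first tensor factor. -/
def traceLeft {X Y : Type*} [Fintype X] (M : Matrix (X × Y) (X × Y) ℂ) : Matrix Y Y ℂ :=
  Matrix.of fun y y' => ∑ x, M (x, y) (x, y')

/-- The partial trace over the second tensor factor. -/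
def traceRight {X Y : Type*} [Fintype Y] (M : Matrix (X × Y) (X × Y) ℂ) : Matrix X X ℂ :=
  Matrix.of fun x x' => ∑ y, M (x, y) (x', y)

/-- The logarithm of a Hermitian matrix, by functional calculus. As `Real.log 0 = 0`, for a positive
semidefinite matrix this is the logarithm on the support, extended by zero on the kernel. -/
noncomputable def logm {X : Type*} [Fintype X] [DecidableEq X] (M : Matrix X X ℂ) :
    Matrix X X ℂ :=
  cfc Real.log M

/-- The von Neumann entropy `S(ρ) = -Tr (ρ log ρ)`, as a real number. -/
noncomputable def entropy {X : Type*} [Fintype X] [DecidableEq X] (ρ : Matrix X X ℂ) : ℝ :=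
  -(ρ * logm ρ).trace.re

section Tripartite

variable {A B C : Type*}

/-- Reduced density matrix on `AB`. -/
def rhoAB [Fintype C] (ρ : Matrix ((A × B) × C) ((A × B) × C) ℂ) :
    Matrix (A × B) (A × B) ℂ :=
  traceRight ρ

/-- Reduced density matrix on `BC`. -/
def rhoBC [Fintype A] (ρ : Matrix ((A × B) × C) ((A × B) × C) ℂ) :
    Matrix (B × C) (B × C) ℂ :=
  traceLeft (Matrix.reindex (Equiv.prodAssoc A B C) (Equiv.prodAssoc A B C) ρ)

/-- Reduced density matrix on `B`. -/
def rhoB [Fintype A] [Fintype C] (ρ : Matrix ((A × B) × C) ((A × B) × C) ℂ) :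
    Matrix B B ℂ :=
  traceLeft (traceRight ρ)

variable [Fintype A] [DecidableEq A] [Fintype B] [DecidableEq B] [Fintype C] [DecidableEq C]

/-- `H_ABC = -log ρ_ABC`. -/
noncomputable def hABC (ρ : Matrix ((A × B) × C) ((A × B) × C) ℂ) :
    Matrix ((A × B) × C) ((A × B) × C) ℂ :=
  -logm ρ

/-- `H_AB = -(log ρ_AB) ⊗ I_C`. -/
noncomputable def hAB (ρ : Matrix ((A × B) × C) ((A × B) × C) ℂ) :
    Matrix ((A × B) × C) ((A × B) × C) ℂ :=
  -(logm (rhoAB ρ) ⊗ₖ (1 : Matrix C C ℂ))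

/-- `H_BC = -I_A ⊗ log ρ_BC`. -/
noncomputable def hBC (ρ : Matrix ((A × B) × C) ((A × B) × C) ℂ) :
    Matrix ((A × B) × C) ((A × B) × C) ℂ :=
  -Matrix.reindex (Equiv.prodAssoc A B C).symm (Equiv.prodAssoc A B C).symm
    ((1 : Matrix A A ℂ) ⊗ₖ logm (rhoBC ρ))

/-- `H_B = -I_A ⊗ log ρ_B ⊗ I_C`. -/
noncomputable def hB (ρ : Matrix ((A × B) × C) ((A × B) × C) ℂ) :
    Matrix ((A × B) × C) ((A × B) × C) ℂ :=
  -(((1 : Matrix A A ℂ) ⊗ₖ logm (rhoB ρ)) ⊗ₖ (1 : Matrix C C ℂ))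

/-- The operator `Tr_AB (ρ_ABC (H_AB + H_BC - H_B - H_ABC))` on `C`. -/
noncomputable def ssaOperator (ρ : Matrix ((A × B) × C) ((A × B) × C) ℂ) : Matrix C C ℂ :=
  traceLeft (ρ * (hAB ρ + hBC ρ - hB ρ - hABC ρ))

end Tripartite

end OperatorSSA

/-!
The operator `T_C` is a difference of two operators of the same kind. For a state `ρ` on `X ⊗ C` with
marginal `ρ_X`, put `D(ρ) = Tr_X (ρ (log ρ - log ρ_X ⊗ I))` (`condOperator`). Then
`T_C = D(ρ_ABC) - D(ρ_BC)`, with `X = AB` and `X = B` respectively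
(`ssaOperator_eq_condOperator_sub`), so positivity of `T_C` says that `D` decreases when `A` is traced
out.

For a vector `c` on `C` and `K = I_X ⊗ |c⟩`, the quadratic form `⟨c, D(ρ) c⟩` equals
`Tr (Kᴴ ρ (log ρ) K) - Tr (Kᴴ ρ K log ρ_X)`, a relative entropy of `ρ` and `ρ_X` weighted by `K`.
Expanded in eigenbases of `ρ` (eigenvalues `λ i`) and of `ρ_X` (eigenvalues `μ j`) it is
`∑ i j, |K i j|² * λ i * (log (λ i) - log (μ j))`. Because the derivative of `log (λ + s * μ)` in `s`
is `μ / (λ + s * μ)`, monotonicity of this sum reduces, as `Tr (Kᴴ ρ K)` is unchanged, to the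
reverse monotonicity, for each `s > 0`, of
`∑ i j, |K i j|² * λ i * s * μ j / (λ i + s * μ j)` (`sum_mul_log_sub_log_le`). The latter is a parallel
sum, hence a minimum: it equals
`min_Y Tr ((K - Y)ᴴ ρ (K - Y)) + s * Tr (Yᴴ Y ρ_X)` (`parallelForm_le`, `exists_parallelForm_eq`).
A competitor `Y` for `ρ_BC` and `ρ_B` gives the competitor `I_A ⊗ Y` for `ρ_ABC` and `ρ_AB`, at the same
cost, since both traces see only the reduced states. This is the required inequality
(`trace_relEntropy_mono`, `posSemidef_condOperator_sub`).

The convention for the logarithm on the kernel causes no trouble: if `ρ_X v = 0` then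
`ρ (v ⊗ c) = 0` (`mulVec_idKet_mulVec_eq_zero`), so no pair with `λ i ≠ 0` and `μ j = 0` carries weight.
-/

namespace OperatorSSA

/-! ### A scalar comparison principle for logarithms -/

open Filter Topology in
lemma tendsto_sum_mul_log {ι : Type*} [Fintype ι] (a l m : ι → ℝ)
    (h : ∀ i, a i ≠ 0 → 0 < l i ∧ 0 < m i) :
    Tendsto (fun s : ℝ => ∑ i, a i * Real.log (l i + s * m i) - (∑ i, a i) * Real.log s)
      atTop (𝓝 (∑ i, a i * Real.log (m i))) := by
  have key : ∀ i, Tendsto (fun s : ℝ => a i * Real.log (l i / s + m i)) atTop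
      (𝓝 (a i * Real.log (m i))) := by
    intro i
    by_cases hi : a i = 0
    · simp [hi]
    · have h1 : Tendsto (fun s : ℝ => l i / s + m i) atTop (𝓝 (0 + m i)) :=
        (tendsto_const_nhds.div_atTop tendsto_id).add tendsto_const_nhds
      rw [zero_add] at h1
      exact (h1.log (h i hi).2.ne').const_mul _
  refine (tendsto_finsetSum _ fun i _ => key i).congr' ?_
  filter_upwards [eventually_gt_atTop (0 : ℝ)] with s hs
  rw [Finset.sum_mul, ← Finset.sum_sub_distrib]
  refine Finset.sum_congr rfl fun i _ => ?_
  by_cases hi : a i = 0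
  · simp [hi]
  · obtain ⟨hl, hm⟩ := h i hi
    rw [← mul_sub, ← Real.log_div (by positivity) hs.ne']
    congr 2
    field_simp

lemma hasDerivAt_sum_mul_log {ι : Type*} [Fintype ι] (a l m : ι → ℝ)
    (h : ∀ i, a i ≠ 0 → 0 < l i ∧ 0 < m i) {s : ℝ} (hs : 0 ≤ s) :
    HasDerivAt (fun s : ℝ => ∑ i, a i * Real.log (l i + s * m i))
      (∑ i, a i * (m i / (l i + s * m i))) s := by
  refine HasDerivAt.fun_sum fun i _ => ?_
  by_cases hi : a i = 0
  · simpa [hi] using hasDerivAt_const s (0 : ℝ)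
  · obtain ⟨hl, hm⟩ := h i hi
    have h1 : HasDerivAt (fun s : ℝ => l i + s * m i) (m i) s := by
      simpa using ((hasDerivAt_id s).mul_const (m i)).const_add (l i)
    exact (h1.log (by positivity)).const_mul _

open Filter Topology in
/-- Since `log l - log m = ∫ s in (0, ∞), (1 / (1 + s) - m / (l + s * m))`, a comparison of weighted
averages of `m / (l + s * m)` for every `s` gives a comparison of weighted averages of
`log l - log m`. The weights need not have a sign; they only have to vanish wherever one of the
logarithms is singular. -/
theorem sum_mul_log_sub_log_le {ι κ : Type*} [Fintype ι] [Fintype κ]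
    (a l m : ι → ℝ) (b p q : κ → ℝ)
    (ha : ∀ i, a i ≠ 0 → 0 < l i ∧ 0 < m i) (hb : ∀ i, b i ≠ 0 → 0 < p i ∧ 0 < q i)
    (hsum : ∑ i, a i = ∑ i, b i)
    (hle : ∀ s : ℝ, 0 < s →
      ∑ i, a i * (m i / (l i + s * m i)) ≤ ∑ i, b i * (q i / (p i + s * q i))) :
    ∑ i, b i * (Real.log (p i) - Real.log (q i)) ≤
      ∑ i, a i * (Real.log (l i) - Real.log (m i)) := by
  -- The difference of the logarithmic sums decreases in `s` from its value at `0`, which involves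
  -- `log l` and `log p`, to its limit at infinity, which involves `log m` and `log q`.
  set F : ℝ → ℝ := fun s => ∑ i, a i * Real.log (l i + s * m i) with hF
  set G : ℝ → ℝ := fun s => ∑ i, b i * Real.log (p i + s * q i) with hG
  have hd : ∀ s : ℝ, 0 ≤ s → HasDerivAt (fun s => F s - G s)
      (∑ i, a i * (m i / (l i + s * m i)) - ∑ i, b i * (q i / (p i + s * q i))) s :=
    fun s hs => (hasDerivAt_sum_mul_log a l m ha hs).sub (hasDerivAt_sum_mul_log b p q hb hs)
  have hanti : AntitoneOn (fun s => F s - G s) (Set.Ici 0) := by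
    refine antitoneOn_of_deriv_nonpos (convex_Ici 0)
      (fun s hs => (hd s hs).continuousAt.continuousWithinAt) ?_ ?_
    · intro s hs
      rw [interior_Ici] at hs
      exact (hd s (le_of_lt hs)).differentiableAt.differentiableWithinAt
    · intro s hs
      rw [interior_Ici] at hs
      rw [(hd s (le_of_lt hs)).deriv]
      exact sub_nonpos.2 (hle s hs)
  have hlim := (tendsto_sum_mul_log a l m ha).sub (tendsto_sum_mul_log b p q hb)
  have hfin := le_of_tendsto hlim (b := F 0 - G 0) <| by
    filter_upwards [eventually_ge_atTop (0 : ℝ)] with s hs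
    have := hanti (Set.mem_Ici.2 le_rfl) (Set.mem_Ici.2 hs) hs
    simp only [hF, hG] at this ⊢
    rw [hsum]
    linarith
  simp only [hF, hG, zero_mul, add_zero] at hfin
  simp only [mul_sub, Finset.sum_sub_distrib]
  linarith

/-! ### Spectral expansions -/

section Spectral

open scoped Matrix

variable {m n : Type*} [Fintype m] [DecidableEq m] [Fintype n] [DecidableEq n]

/-- The matrix of `K` with respect to the eigenbasis of `σ` on the source and the eigenbasis of `ρ`
on the target. -/
noncomputable def overlap {ρ : Matrix n n ℂ} {σ : Matrix m m ℂ} (hρ : ρ.IsHermitian)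
    (hσ : σ.IsHermitian) (K : Matrix n m ℂ) : Matrix n m ℂ :=
  (hρ.eigenvectorUnitary : Matrix n n ℂ)ᴴ * K * (hσ.eigenvectorUnitary : Matrix m m ℂ)

variable {ρ : Matrix n n ℂ} {σ : Matrix m m ℂ}

lemma overlap_sub (hρ : ρ.IsHermitian) (hσ : σ.IsHermitian) (K X : Matrix n m ℂ) :
    overlap hρ hσ (K - X) = overlap hρ hσ K - overlap hρ hσ X := by
  simp [overlap, Matrix.mul_sub, Matrix.sub_mul]

lemma exists_overlap_eq (hρ : ρ.IsHermitian) (hσ : σ.IsHermitian) (Y : Matrix n m ℂ) :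
    ∃ X, overlap hρ hσ X = Y := by
  have h1 : (hρ.eigenvectorUnitary : Matrix n n ℂ)ᴴ * hρ.eigenvectorUnitary = 1 :=
    Unitary.coe_star_mul_self hρ.eigenvectorUnitary
  have h2 : (hσ.eigenvectorUnitary : Matrix m m ℂ)ᴴ * hσ.eigenvectorUnitary = 1 :=
    Unitary.coe_star_mul_self hσ.eigenvectorUnitary
  refine ⟨(hρ.eigenvectorUnitary : Matrix n n ℂ) * Y * (hσ.eigenvectorUnitary : Matrix m m ℂ)ᴴ, ?_⟩
  simp only [overlap, ← Matrix.mul_assoc, h1, Matrix.one_mul]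
  rw [Matrix.mul_assoc, h2, Matrix.mul_one]

lemma cfc_eq_conj_diagonal (hρ : ρ.IsHermitian) (f : ℝ → ℝ) :
    cfc f ρ = (hρ.eigenvectorUnitary : Matrix n n ℂ) *
      Matrix.diagonal (fun i => (f (hρ.eigenvalues i) : ℂ)) *
      (hρ.eigenvectorUnitary : Matrix n n ℂ)ᴴ := by
  rw [hρ.cfc_eq]
  simp [Matrix.IsHermitian.cfc, Unitary.conjStarAlgAut_apply, Function.comp_def,
    Matrix.star_eq_conjTranspose]

theorem trace_cfc_mul_cfc (hρ : ρ.IsHermitian) (hσ : σ.IsHermitian) (K : Matrix n m ℂ)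
    (f g : ℝ → ℝ) :
    (Kᴴ * cfc f ρ * K * cfc g σ).trace =
      ((∑ x : n × m, f (hρ.eigenvalues x.1) * g (hσ.eigenvalues x.2) *
        Complex.normSq (overlap hρ hσ K x.1 x.2) : ℝ) : ℂ) := by
  set U := (hρ.eigenvectorUnitary : Matrix n n ℂ) with hU
  set V := (hσ.eigenvectorUnitary : Matrix m m ℂ) with hV
  set W := overlap hρ hσ K with hW
  have hWeq : W = Uᴴ * K * V := rfl
  have hWH : Wᴴ = Vᴴ * Kᴴ * U := by
    simp [hWeq, Matrix.conjTranspose_mul, Matrix.mul_assoc]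
  have h1 : (Kᴴ * cfc f ρ * K * cfc g σ).trace =
      (Wᴴ * Matrix.diagonal (fun i => (f (hρ.eigenvalues i) : ℂ)) * W *
        Matrix.diagonal (fun i => (g (hσ.eigenvalues i) : ℂ))).trace := by
    rw [cfc_eq_conj_diagonal hρ, cfc_eq_conj_diagonal hσ, hWH, hWeq, ← hU, ← hV]
    rw [← Matrix.mul_assoc, Matrix.trace_mul_comm]
    simp only [Matrix.mul_assoc]
  rw [h1, Matrix.trace]
  simp only [Matrix.diag_apply, Matrix.mul_diagonal]
  rw [Fintype.sum_prod_type_right]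
  push_cast
  refine Finset.sum_congr rfl fun j _ => ?_
  rw [Matrix.mul_apply, Finset.sum_mul]
  refine Finset.sum_congr rfl fun i _ => ?_
  rw [Matrix.mul_diagonal, Matrix.conjTranspose_apply, Complex.normSq_eq_conj_mul_self]
  simp only [Complex.star_def]
  ring

theorem trace_conjTranspose_mul_mul (hρ : ρ.IsHermitian) (hσ : σ.IsHermitian)
    (K : Matrix n m ℂ) :
    (Kᴴ * ρ * K).trace = ((∑ x : n × m, hρ.eigenvalues x.1 *
        Complex.normSq (overlap hρ hσ K x.1 x.2) : ℝ) : ℂ) := by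
  have h := trace_cfc_mul_cfc hρ hσ K id (fun _ => 1)
  rw [cfc_id ℝ ρ hρ.isSelfAdjoint, cfc_const_one ℝ σ hσ.isSelfAdjoint] at h
  simpa using h

theorem trace_conjTranspose_mul_self_mul (hρ : ρ.IsHermitian) (hσ : σ.IsHermitian)
    (K : Matrix n m ℂ) :
    (Kᴴ * K * σ).trace = ((∑ x : n × m, hσ.eigenvalues x.2 *
        Complex.normSq (overlap hρ hσ K x.1 x.2) : ℝ) : ℂ) := by
  have h := trace_cfc_mul_cfc hρ hσ K (fun _ => 1) id
  rw [cfc_id ℝ σ hσ.isSelfAdjoint, cfc_const_one ℝ ρ hρ.isSelfAdjoint] at h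
  simpa using h

theorem trace_mul_logm (hρ : ρ.IsHermitian) (hσ : σ.IsHermitian) (K : Matrix n m ℂ) :
    (Kᴴ * (ρ * logm ρ) * K).trace = ((∑ x : n × m, hρ.eigenvalues x.1 *
      Real.log (hρ.eigenvalues x.1) * Complex.normSq (overlap hρ hσ K x.1 x.2) : ℝ) : ℂ) := by
  have h := trace_cfc_mul_cfc hρ hσ K (fun x => x * Real.log x) (fun _ => 1)
  rw [cfc_const_one ℝ σ hσ.isSelfAdjoint, cfc_mul (fun x : ℝ => x) Real.log ρ
    (Matrix.finite_real_spectrum.continuousOn _) (Matrix.finite_real_spectrum.continuousOn _),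
    cfc_id' ℝ ρ hρ.isSelfAdjoint] at h
  simpa [logm] using h

theorem trace_mul_mul_logm (hρ : ρ.IsHermitian) (hσ : σ.IsHermitian) (K : Matrix n m ℂ) :
    (Kᴴ * ρ * K * logm σ).trace = ((∑ x : n × m, hρ.eigenvalues x.1 *
      Real.log (hσ.eigenvalues x.2) * Complex.normSq (overlap hρ hσ K x.1 x.2) : ℝ) : ℂ) := by
  have h := trace_cfc_mul_cfc hρ hσ K id Real.log
  rw [cfc_id ℝ ρ hρ.isSelfAdjoint] at h
  simpa [logm] using h

/-- If `ρ` annihilates the image under `K` of the kernel of `σ`, an eigenvector of `ρ` with nonzero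
eigenvalue only overlaps eigenvectors of `σ` with nonzero eigenvalue. -/
lemma overlap_eq_zero (hρ : ρ.IsHermitian) (hσ : σ.IsHermitian) (K : Matrix n m ℂ)
    (hker : ∀ v, σ.mulVec v = 0 → ρ.mulVec (K.mulVec v) = 0) {i : n} {j : m}
    (hi : hρ.eigenvalues i ≠ 0) (hj : hσ.eigenvalues j = 0) : overlap hρ hσ K i j = 0 := by
  set U := (hρ.eigenvectorUnitary : Matrix n n ℂ) with hU
  set V := (hσ.eigenvectorUnitary : Matrix m m ℂ) with hV
  have h0 : ρ.mulVec (K.mulVec (V.mulVec (Pi.single j 1))) = 0 := by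
    apply hker
    rw [Matrix.mulVec_single_one]
    have h := hσ.mulVec_eigenvectorBasis j
    rw [hj, zero_smul] at h
    rw [← h]
    congr 1
  have hUU : Uᴴ * U = 1 := Unitary.coe_star_mul_self hρ.eigenvectorUnitary
  have hρeq : Uᴴ * ρ = Matrix.diagonal (fun i => (hρ.eigenvalues i : ℂ)) * Uᴴ := by
    conv_lhs => rw [← cfc_id ℝ ρ hρ.isSelfAdjoint, cfc_eq_conj_diagonal hρ, ← hU]
    simp only [← Matrix.mul_assoc, hUU, Matrix.one_mul, id]
  have h1 : (Uᴴ * ρ * K * V).mulVec (Pi.single j 1) i = 0 := by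
    simp only [← Matrix.mulVec_mulVec, h0, Matrix.mulVec_zero, Pi.zero_apply]
  rw [hρeq, Matrix.mulVec_single_one, Matrix.mul_assoc, Matrix.mul_assoc,
    Matrix.col_apply, Matrix.diagonal_mul, mul_eq_zero, ← Matrix.mul_assoc] at h1
  exact h1.resolve_left (by exact_mod_cast hi)

end Spectral


/-! ### Monotonicity of the weighted relative entropy -/

/-- The parallel sum `a * b / (a + b)`, applied to `‖w‖ ^ 2`, is a lower bound for
`a * ‖w - y‖ ^ 2 + b * ‖y‖ ^ 2`. The bound also holds when `a = b = 0`, as `0 / 0 = 0`. -/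
lemma parallel_mul_normSq_le {a b : ℝ} (ha : 0 ≤ a) (hb : 0 ≤ b) (w y : ℂ) :
    a * b / (a + b) * Complex.normSq w ≤
      a * Complex.normSq (w - y) + b * Complex.normSq y := by
  rcases (add_nonneg ha hb).eq_or_lt with h | h
  · rw [← h, div_zero, zero_mul]
    have := Complex.normSq_nonneg (w - y)
    have := Complex.normSq_nonneg y
    positivity
  · rw [div_mul_eq_mul_div, div_le_iff₀ h]
    simp only [Complex.normSq_apply, Complex.sub_re, Complex.sub_im]
    nlinarith [sq_nonneg ((a + b) * y.re - a * w.re), sq_nonneg ((a + b) * y.im - a * w.im)]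

/-- The bound `parallel_mul_normSq_le` is attained at `y = a / (a + b) * w`. -/
lemma parallel_mul_normSq_eq {a b : ℝ} (ha : 0 ≤ a) (hb : 0 ≤ b) (w : ℂ) :
    a * Complex.normSq (w - (a / (a + b) : ℝ) * w) +
      b * Complex.normSq ((a / (a + b) : ℝ) * w) = a * b / (a + b) * Complex.normSq w := by
  rcases (add_nonneg ha hb).eq_or_lt with h | h
  · obtain rfl : a = 0 := by linarith
    obtain rfl : b = 0 := by linarith
    simp
  · have h1 : w - (a / (a + b) : ℝ) * w = ((b / (a + b) : ℝ) : ℂ) * w := by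
      have : (b / (a + b) : ℝ) = 1 - a / (a + b) := by field_simp; ring
      rw [this]; push_cast; ring
    rw [h1, Complex.normSq_mul, Complex.normSq_mul, Complex.normSq_ofReal, Complex.normSq_ofReal]
    field_simp
    ring

section Monotone

open scoped Matrix

variable {m n m' n' : Type*} [Fintype m] [DecidableEq m] [Fintype n] [DecidableEq n]
  [Fintype m'] [DecidableEq m'] [Fintype n'] [DecidableEq n']
  {ρ : Matrix n n ℂ} {σ : Matrix m m ℂ} {ρ' : Matrix n' n' ℂ} {σ' : Matrix m' m' ℂ}

/-- The quadratic form of the parallel sum of left multiplication by `ρ` and `s` times right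
multiplication by `σ`, evaluated at `K`. -/
noncomputable def parallelForm (hρ : ρ.IsHermitian) (hσ : σ.IsHermitian) (s : ℝ)
    (K : Matrix n m ℂ) : ℝ :=
  ∑ x : n × m, hρ.eigenvalues x.1 * (s * hσ.eigenvalues x.2) /
    (hρ.eigenvalues x.1 + s * hσ.eigenvalues x.2) * Complex.normSq (overlap hρ hσ K x.1 x.2)

lemma trace_sub_add_trace_eq_sum (hρ : ρ.IsHermitian) (hσ : σ.IsHermitian) (s : ℝ)
    (K X : Matrix n m ℂ) :
    ((K - X)ᴴ * ρ * (K - X)).trace.re + s * (Xᴴ * X * σ).trace.re =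
      ∑ x : n × m, (hρ.eigenvalues x.1 *
          Complex.normSq (overlap hρ hσ K x.1 x.2 - overlap hρ hσ X x.1 x.2) +
        s * hσ.eigenvalues x.2 * Complex.normSq (overlap hρ hσ X x.1 x.2)) := by
  rw [trace_conjTranspose_mul_mul hρ hσ, trace_conjTranspose_mul_self_mul hρ hσ,
    Complex.ofReal_re, Complex.ofReal_re, overlap_sub, Finset.sum_add_distrib, Finset.mul_sum]
  simp only [Matrix.sub_apply, mul_assoc]

theorem parallelForm_le (hρ : ρ.PosSemidef) (hσ : σ.PosSemidef) {s : ℝ} (hs : 0 ≤ s)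
    (K X : Matrix n m ℂ) :
    parallelForm hρ.isHermitian hσ.isHermitian s K ≤
      ((K - X)ᴴ * ρ * (K - X)).trace.re + s * (Xᴴ * X * σ).trace.re := by
  rw [trace_sub_add_trace_eq_sum hρ.isHermitian hσ.isHermitian]
  exact Finset.sum_le_sum fun x _ => parallel_mul_normSq_le (hρ.eigenvalues_nonneg _)
    (mul_nonneg hs (hσ.eigenvalues_nonneg _)) _ _

theorem exists_parallelForm_eq (hρ : ρ.PosSemidef) (hσ : σ.PosSemidef) {s : ℝ} (hs : 0 ≤ s)
    (K : Matrix n m ℂ) :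
    ∃ X : Matrix n m ℂ, ((K - X)ᴴ * ρ * (K - X)).trace.re + s * (Xᴴ * X * σ).trace.re =
      parallelForm hρ.isHermitian hσ.isHermitian s K := by
  obtain ⟨X, hX⟩ := exists_overlap_eq hρ.isHermitian hσ.isHermitian (Matrix.of fun i j =>
    ((hρ.isHermitian.eigenvalues i / (hρ.isHermitian.eigenvalues i +
      s * hσ.isHermitian.eigenvalues j) : ℝ) : ℂ) * overlap hρ.isHermitian hσ.isHermitian K i j)
  refine ⟨X, ?_⟩
  rw [trace_sub_add_trace_eq_sum hρ.isHermitian hσ.isHermitian, hX]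
  exact Finset.sum_congr rfl fun x _ => parallel_mul_normSq_eq (hρ.eigenvalues_nonneg _)
    (mul_nonneg hs (hσ.eigenvalues_nonneg _)) _

lemma eigenvalues_pos_of_weight_ne_zero (hρ : ρ.PosSemidef) (hσ : σ.PosSemidef)
    (K : Matrix n m ℂ) (hker : ∀ v, σ.mulVec v = 0 → ρ.mulVec (K.mulVec v) = 0) (x : n × m)
    (hx : hρ.isHermitian.eigenvalues x.1 *
      Complex.normSq (overlap hρ.isHermitian hσ.isHermitian K x.1 x.2) ≠ 0) :
    0 < hρ.isHermitian.eigenvalues x.1 ∧ 0 < hσ.isHermitian.eigenvalues x.2 := by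
  have h1 := left_ne_zero_of_mul hx
  refine ⟨lt_of_le_of_ne (hρ.eigenvalues_nonneg _) h1.symm,
    lt_of_le_of_ne (hσ.eigenvalues_nonneg _) fun h2 => right_ne_zero_of_mul hx ?_⟩
  rw [overlap_eq_zero hρ.isHermitian hσ.isHermitian K hker h1 h2.symm, map_zero]

/-- Monotonicity of `Kᴴ ρ (log ρ) K - Kᴴ ρ K log σ` in trace. The assumption `hlift` says that
competitors in the variational formula for the parallel sum of `ρ'` and `σ'` lift to competitors of
the same cost for `ρ` and `σ`; the kernel conditions keep the logarithm of `σ` away from its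
singularity. -/
theorem trace_relEntropy_mono (hρ : ρ.PosSemidef) (hσ : σ.PosSemidef) (hρ' : ρ'.PosSemidef)
    (hσ' : σ'.PosSemidef) (K : Matrix n m ℂ) (K' : Matrix n' m' ℂ)
    (hker : ∀ v, σ.mulVec v = 0 → ρ.mulVec (K.mulVec v) = 0)
    (hker' : ∀ v, σ'.mulVec v = 0 → ρ'.mulVec (K'.mulVec v) = 0)
    (htrace : (Kᴴ * ρ * K).trace = (K'ᴴ * ρ' * K').trace)
    (hlift : ∀ X' : Matrix n' m' ℂ, ∃ X : Matrix n m ℂ,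
      ((K - X)ᴴ * ρ * (K - X)).trace = ((K' - X')ᴴ * ρ' * (K' - X')).trace ∧
      (Xᴴ * X * σ).trace = (X'ᴴ * X' * σ').trace) :
    (K'ᴴ * (ρ' * logm ρ') * K').trace.re - (K'ᴴ * ρ' * K' * logm σ').trace.re ≤
      (Kᴴ * (ρ * logm ρ) * K).trace.re - (Kᴴ * ρ * K * logm σ).trace.re := by
  have key := sum_mul_log_sub_log_le _ (fun x : n × m => hρ.isHermitian.eigenvalues x.1)
    (fun x : n × m => hσ.isHermitian.eigenvalues x.2) _
    (fun x : n' × m' => hρ'.isHermitian.eigenvalues x.1)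
    (fun x : n' × m' => hσ'.isHermitian.eigenvalues x.2)
    (eigenvalues_pos_of_weight_ne_zero hρ hσ K hker)
    (eigenvalues_pos_of_weight_ne_zero hρ' hσ' K' hker') ?_ ?_
  · rw [trace_mul_logm hρ.isHermitian hσ.isHermitian, trace_mul_mul_logm hρ.isHermitian
      hσ.isHermitian, trace_mul_logm hρ'.isHermitian hσ'.isHermitian, trace_mul_mul_logm
      hρ'.isHermitian hσ'.isHermitian]
    simp only [Complex.ofReal_re, ← Finset.sum_sub_distrib]
    convert key using 2 <;> ring
  · rw [trace_conjTranspose_mul_mul hρ.isHermitian hσ.isHermitian,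
      trace_conjTranspose_mul_mul hρ'.isHermitian hσ'.isHermitian] at htrace
    exact_mod_cast htrace
  · intro s hs
    obtain ⟨X', hX'⟩ := exists_parallelForm_eq hρ' hσ' hs.le K'
    obtain ⟨X, h1, h2⟩ := hlift X'
    have h := parallelForm_le hρ hσ hs.le K X
    rw [h1, h2, hX'] at h
    refine le_of_mul_le_mul_left ?_ hs
    simp only [Finset.mul_sum]
    simp only [parallelForm] at h
    refine (Finset.sum_congr rfl fun x _ => ?_).trans_le
      (h.trans_eq (Finset.sum_congr rfl fun x _ => ?_)) <;> ring

end Monotone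


section PartialTrace

open scoped Matrix

/-! ### Partial traces -/

variable {A B C X : Type*}

lemma trace_traceLeft [Fintype X] [Fintype C] (M : Matrix (X × C) (X × C) ℂ) :
    (traceLeft M).trace = M.trace := by
  simp only [Matrix.trace, Matrix.diag_apply, traceLeft, Matrix.of_apply]
  rw [Fintype.sum_prod_type_right]

lemma traceLeft_eq_sum_submatrix [Fintype X] (M : Matrix (X × C) (X × C) ℂ) :
    traceLeft M = ∑ x, M.submatrix (Prod.mk x) (Prod.mk x) := by
  ext
  simp [traceLeft, Matrix.sum_apply]

lemma traceRight_eq_sum_submatrix [Fintype C] (M : Matrix (X × C) (X × C) ℂ) :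
    traceRight M = ∑ c, M.submatrix (fun x => (x, c)) (fun x => (x, c)) := by
  ext
  simp [traceRight, Matrix.sum_apply]

lemma posSemidef_traceLeft [Fintype X] {M : Matrix (X × C) (X × C) ℂ} (hM : M.PosSemidef) :
    (traceLeft M).PosSemidef := by
  rw [traceLeft_eq_sum_submatrix]
  exact Matrix.posSemidef_sum _ fun x _ => hM.submatrix _

lemma posSemidef_traceRight [Fintype C] {M : Matrix (X × C) (X × C) ℂ} (hM : M.PosSemidef) :
    (traceRight M).PosSemidef := by
  rw [traceRight_eq_sum_submatrix]
  exact Matrix.posSemidef_sum _ fun x _ => hM.submatrix _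

lemma posSemidef_rhoBC [Fintype A] {ρ : Matrix ((A × B) × C) ((A × B) × C) ℂ}
    (hρ : ρ.PosSemidef) : (rhoBC ρ).PosSemidef :=
  posSemidef_traceLeft (hρ.submatrix _)

lemma traceRight_rhoBC [Fintype A] [Fintype C] (ρ : Matrix ((A × B) × C) ((A × B) × C) ℂ) :
    traceRight (rhoBC ρ) = rhoB ρ := by
  ext b b'
  simp only [traceRight, rhoBC, traceLeft, rhoB, Matrix.of_apply]
  exact Finset.sum_comm

lemma conjTranspose_traceLeft [Fintype X] (M : Matrix (X × C) (X × C) ℂ) :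
    (traceLeft M)ᴴ = traceLeft Mᴴ := by
  ext
  simp [traceLeft]

lemma traceLeft_mul_kronecker_one [Fintype X] [Fintype C] [DecidableEq C]
    (M : Matrix (X × C) (X × C) ℂ)
    (L : Matrix X X ℂ) :
    traceLeft (M * (L ⊗ₖ (1 : Matrix C C ℂ))) = traceLeft ((L ⊗ₖ (1 : Matrix C C ℂ)) * M) := by
  ext c c'
  simp only [traceLeft, Matrix.of_apply, Matrix.mul_apply, Fintype.sum_prod_type,
    Matrix.kroneckerMap_apply, Matrix.one_apply, mul_ite, ite_mul, mul_one, mul_zero, zero_mul,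
    Finset.sum_ite_eq, Finset.sum_ite_eq', Finset.mem_univ, if_true]
  rw [Finset.sum_comm]
  simp only [mul_comm]

lemma trace_mul_kronecker_one [Fintype X] [Fintype C] [DecidableEq C]
    (M : Matrix (X × C) (X × C) ℂ)
    (L : Matrix X X ℂ) :
    (M * (L ⊗ₖ (1 : Matrix C C ℂ))).trace = (traceRight M * L).trace := by
  simp only [traceRight, Matrix.trace, Matrix.diag_apply, Matrix.of_apply, Matrix.mul_apply,
    Fintype.sum_prod_type, Matrix.kroneckerMap_apply, Matrix.one_apply, mul_ite, mul_one, mul_zero,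
    Finset.sum_ite_eq', Finset.mem_univ, if_true, Finset.sum_mul]
  exact Finset.sum_congr rfl fun x _ => Finset.sum_comm

lemma trace_one_kronecker_mul [Fintype A] [Fintype B] [DecidableEq A] (Y : Matrix B B ℂ)
    (M : Matrix (A × B) (A × B) ℂ) :
    (((1 : Matrix A A ℂ) ⊗ₖ Y) * M).trace = (Y * traceLeft M).trace := by
  simp only [traceLeft, Matrix.trace, Matrix.diag_apply, Matrix.of_apply, Matrix.mul_apply,
    Fintype.sum_prod_type, Matrix.kroneckerMap_apply, Matrix.one_apply, ite_mul, one_mul, zero_mul,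
    Finset.sum_ite_irrel, Finset.sum_const_zero,
    Finset.sum_ite_eq, Finset.mem_univ, if_true, Finset.mul_sum]
  rw [Finset.sum_comm]
  exact Finset.sum_congr rfl fun x _ => Finset.sum_comm

/-- Tracing out `AB` against an operator that acts only on `BC` can be done in the reduced density
matrix of `BC`. -/
lemma traceLeft_mul_one_kronecker [Fintype A] [Fintype B] [Fintype C]
    [DecidableEq A]
    (ρ : Matrix ((A × B) × C) ((A × B) × C) ℂ) (Z : Matrix (B × C) (B × C) ℂ) :
    traceLeft (ρ * Matrix.reindex (Equiv.prodAssoc A B C).symm (Equiv.prodAssoc A B C).symm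
      ((1 : Matrix A A ℂ) ⊗ₖ Z)) = traceLeft (rhoBC ρ * Z) := by
  ext c c'
  simp only [traceLeft, rhoBC, Matrix.of_apply, Matrix.mul_apply, Fintype.sum_prod_type,
    Matrix.reindex_apply, Matrix.submatrix_apply, Equiv.symm_symm, Equiv.prodAssoc_apply,
    Equiv.prodAssoc_symm_apply, Matrix.kroneckerMap_apply, Matrix.one_apply, ite_mul, one_mul,
    zero_mul, mul_ite, mul_zero, Finset.sum_ite_irrel, Finset.sum_const_zero, Finset.sum_ite_eq',
    Finset.mem_univ, if_true, Finset.sum_mul]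
  rw [Finset.sum_comm]
  refine Finset.sum_congr rfl fun b _ => ?_
  rw [Finset.sum_comm]
  exact Finset.sum_congr rfl fun b' _ => Finset.sum_comm

/-! ### Tensoring with a vector and with an identity -/

/-- The operator `I ⊗ |c⟩` from the Hilbert space of `X` to that of `X × C`. -/
def idKet (X : Type*) [DecidableEq X] (c : C → ℂ) : Matrix (X × C) X ℂ :=
  Matrix.of fun p x => if p.1 = x then c p.2 else 0

/-- The operator `I_A ⊗ Y`, with the tensor factors of its target reassociated. -/
def liftLeft (A : Type*) [DecidableEq A] (Y : Matrix (B × C) B ℂ) :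
    Matrix ((A × B) × C) (A × B) ℂ :=
  ((1 : Matrix A A ℂ) ⊗ₖ Y).submatrix (Equiv.prodAssoc A B C) id

lemma dotProduct_traceLeft_mulVec [Fintype X] [Fintype C] [DecidableEq X]
    (M : Matrix (X × C) (X × C) ℂ) (c : C → ℂ) :
    star c ⬝ᵥ (traceLeft M).mulVec c = ((idKet X c)ᴴ * M * idKet X c).trace := by
  have h : ∀ x, ((idKet X c)ᴴ * M * idKet X c) x x =
      star c ⬝ᵥ (M.submatrix (Prod.mk x) (Prod.mk x)).mulVec c := by
    intro x
    rw [Matrix.mul_assoc]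
    simp [idKet, Matrix.mul_apply, dotProduct, Matrix.mulVec, Fintype.sum_prod_type, apply_ite]
  rw [traceLeft_eq_sum_submatrix, Matrix.sum_mulVec, dotProduct_sum]
  exact Finset.sum_congr rfl fun x _ => (h x).symm

lemma kronecker_one_mul_idKet [Fintype X] [Fintype C] [DecidableEq X] [DecidableEq C]
    (L : Matrix X X ℂ) (c : C → ℂ) :
    (L ⊗ₖ (1 : Matrix C C ℂ)) * idKet X c = idKet X c * L := by
  ext ⟨x, d⟩ y
  simp [idKet, Matrix.mul_apply, Fintype.sum_prod_type, Matrix.one_apply, mul_comm]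

lemma idKet_mulVec [Fintype X] [DecidableEq X] (c : C → ℂ) (v : X → ℂ) :
    (idKet X c).mulVec v = fun p => v p.1 * c p.2 := by
  ext ⟨x, d⟩
  simp [idKet, Matrix.mulVec, dotProduct, mul_comm]

/-- The support of `ρ` lies in the support of its marginal on `X`, tensored with the whole space. -/
lemma mulVec_idKet_mulVec_eq_zero [Fintype X] [Fintype C] [DecidableEq X]
    [DecidableEq C] {ρ : Matrix (X × C) (X × C) ℂ} (hρ : ρ.PosSemidef) (c : C → ℂ)
    (v : X → ℂ) (hv : (traceRight ρ).mulVec v = 0) : ρ.mulVec ((idKet X c).mulVec v) = 0 := by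
  have hsum : ∑ d : C,
      star v ⬝ᵥ (ρ.submatrix (fun x => (x, d)) (fun x => (x, d))).mulVec v = 0 := by
    rw [← dotProduct_sum, ← Matrix.sum_mulVec, ← traceRight_eq_sum_submatrix, hv, dotProduct_zero]
  have hd : ∀ d : C, ρ.mulVec ((idKet X (Pi.single d 1)).mulVec v) = 0 := by
    intro d
    have h := (Finset.sum_eq_zero_iff_of_nonneg fun d _ =>
      (hρ.submatrix fun x => (x, d)).dotProduct_mulVec_nonneg v).1 hsum d (Finset.mem_univ d)
    rw [← hρ.dotProduct_mulVec_zero_iff, ← h]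
    rw [idKet_mulVec]
    simp [dotProduct, Matrix.mulVec, Fintype.sum_prod_type, Pi.single_apply, apply_ite]
  -- The claim is linear in `c`, so it follows from the case of basis vectors.
  have hc : (idKet X c).mulVec v = ∑ d, c d • (idKet X (Pi.single d 1)).mulVec v := by
    ext ⟨x, d⟩
    simp [idKet_mulVec, Finset.sum_apply, Pi.single_apply, mul_comm]
  rw [hc, Matrix.mulVec_sum]
  exact Finset.sum_eq_zero fun d _ => by rw [Matrix.mulVec_smul, hd, smul_zero]

lemma liftLeft_sub [DecidableEq A] (Y Z : Matrix (B × C) B ℂ) :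
    liftLeft A (Y - Z) = liftLeft A Y - liftLeft A Z := by
  ext
  simp [liftLeft, mul_sub]

lemma liftLeft_idKet [DecidableEq A] [DecidableEq B] (c : C → ℂ) :
    liftLeft A (idKet B c) = idKet (A × B) c := by
  ext ⟨⟨a, b⟩, d⟩ ⟨a', b'⟩
  by_cases h : a = a' <;> simp [liftLeft, idKet, h]

lemma trace_conjTranspose_liftLeft_mul [Fintype A] [Fintype B] [Fintype C]
    [DecidableEq A] (ρ : Matrix ((A × B) × C) ((A × B) × C) ℂ)
    (Y : Matrix (B × C) B ℂ) :
    ((liftLeft A Y)ᴴ * ρ * liftLeft A Y).trace = (Yᴴ * rhoBC ρ * Y).trace := by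
  have h : liftLeft A Y * (liftLeft A Y)ᴴ = Matrix.reindex (Equiv.prodAssoc A B C).symm
      (Equiv.prodAssoc A B C).symm ((1 : Matrix A A ℂ) ⊗ₖ (Y * Yᴴ)) := by
    rw [liftLeft, Matrix.conjTranspose_submatrix,
      ← Matrix.submatrix_mul _ _ _ id _ Function.bijective_id,
      Matrix.conjTranspose_kronecker, ← Matrix.mul_kronecker_mul]
    simp
  rw [Matrix.mul_assoc, Matrix.trace_mul_comm, Matrix.mul_assoc, h, ← trace_traceLeft,
    traceLeft_mul_one_kronecker, trace_traceLeft, ← Matrix.mul_assoc, Matrix.trace_mul_comm,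
    Matrix.mul_assoc]

lemma trace_conjTranspose_liftLeft_mul_self [Fintype A] [Fintype B] [Fintype C]
    [DecidableEq A] (M : Matrix (A × B) (A × B) ℂ)
    (Y : Matrix (B × C) B ℂ) :
    ((liftLeft A Y)ᴴ * liftLeft A Y * M).trace = (Yᴴ * Y * traceLeft M).trace := by
  have h : (liftLeft A Y)ᴴ * liftLeft A Y = (1 : Matrix A A ℂ) ⊗ₖ (Yᴴ * Y) := by
    rw [liftLeft, Matrix.conjTranspose_submatrix, Matrix.submatrix_mul_equiv,
      Matrix.conjTranspose_kronecker, ← Matrix.mul_kronecker_mul]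
    simp
  rw [h, trace_one_kronecker_mul]

end PartialTrace

/-! ### The conditional entropy operator -/

section CondOperator

open scoped Matrix

variable {A B C X : Type*} [Fintype A] [DecidableEq A] [Fintype B] [DecidableEq B] [Fintype C]
  [DecidableEq C] [Fintype X] [DecidableEq X]

/-- The operator `Tr_X (ρ (log ρ - log ρ_X ⊗ I))` on `C`, for `ρ` on `X ⊗ C` with marginal `ρ_X`.
Its trace is the negative of the conditional entropy of `C` given `X`. -/
noncomputable def condOperator (ρ : Matrix (X × C) (X × C) ℂ) : Matrix C C ℂ :=
  traceLeft (ρ * logm ρ) - traceLeft (ρ * (logm (traceRight ρ) ⊗ₖ (1 : Matrix C C ℂ)))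

lemma isHermitian_logm (M : Matrix X X ℂ) : (logm M).IsHermitian :=
  cfc_predicate (R := ℝ) Real.log M

lemma commute_logm {M : Matrix X X ℂ} (hM : M.IsHermitian) : Commute M (logm M) := by
  have h := cfc_commute_cfc (fun x : ℝ => x) Real.log M
  rwa [cfc_id' ℝ M hM.isSelfAdjoint] at h

lemma trace_mul_logm_eq_neg_entropy {ρ : Matrix X X ℂ} (hρ : ρ.IsHermitian) :
    (ρ * logm ρ).trace = ((-entropy ρ : ℝ) : ℂ) := by
  have h := trace_mul_logm hρ hρ 1
  rw [Matrix.conjTranspose_one, Matrix.one_mul, Matrix.mul_one] at h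
  rw [entropy, neg_neg, h, Complex.ofReal_re]

lemma isHermitian_condOperator {ρ : Matrix (X × C) (X × C) ℂ} (hρ : ρ.IsHermitian) :
    (condOperator ρ).IsHermitian := by
  rw [condOperator]
  refine Matrix.IsHermitian.sub ?_ ?_
  · rw [Matrix.IsHermitian, conjTranspose_traceLeft, Matrix.conjTranspose_mul, hρ.eq,
      (isHermitian_logm ρ).eq, (commute_logm hρ).eq]
  · rw [Matrix.IsHermitian, conjTranspose_traceLeft, Matrix.conjTranspose_mul, hρ.eq,
      Matrix.conjTranspose_kronecker, (isHermitian_logm _).eq, Matrix.conjTranspose_one,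
      traceLeft_mul_kronecker_one]

lemma trace_condOperator {ρ : Matrix (X × C) (X × C) ℂ} (hρ : ρ.PosSemidef) :
    (condOperator ρ).trace = ((entropy (traceRight ρ) - entropy ρ : ℝ) : ℂ) := by
  rw [condOperator, Matrix.trace_sub, trace_traceLeft, trace_traceLeft, trace_mul_kronecker_one,
    trace_mul_logm_eq_neg_entropy hρ.isHermitian,
    trace_mul_logm_eq_neg_entropy (posSemidef_traceRight hρ).isHermitian]
  push_cast
  ring

lemma dotProduct_condOperator_mulVec (ρ : Matrix (X × C) (X × C) ℂ) (c : C → ℂ) :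
    star c ⬝ᵥ (condOperator ρ).mulVec c =
      ((idKet X c)ᴴ * (ρ * logm ρ) * idKet X c).trace -
        ((idKet X c)ᴴ * ρ * idKet X c * logm (traceRight ρ)).trace := by
  rw [condOperator, Matrix.sub_mulVec, dotProduct_sub, dotProduct_traceLeft_mulVec,
    dotProduct_traceLeft_mulVec, Matrix.mul_assoc _ (ρ * _) , Matrix.mul_assoc _ (ρ * _),
    Matrix.mul_assoc ρ (_ ⊗ₖ _), kronecker_one_mul_idKet]
  simp only [Matrix.mul_assoc]

lemma ssaOperator_eq_condOperator_sub (ρ : Matrix ((A × B) × C) ((A × B) × C) ℂ) :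
    ssaOperator ρ = condOperator ρ - condOperator (rhoBC ρ) := by
  have hL : ∀ M N : Matrix ((A × B) × C) ((A × B) × C) ℂ,
      traceLeft (M - N) = traceLeft M - traceLeft N := fun M N => by
    ext; simp [traceLeft]
  have hassoc : ((1 : Matrix A A ℂ) ⊗ₖ logm (rhoB ρ)) ⊗ₖ (1 : Matrix C C ℂ) =
      Matrix.reindex (Equiv.prodAssoc A B C).symm (Equiv.prodAssoc A B C).symm
        ((1 : Matrix A A ℂ) ⊗ₖ (logm (rhoB ρ) ⊗ₖ (1 : Matrix C C ℂ))) := by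
    ext
    simp [mul_assoc]
  -- The `ABC` and `AB` terms form one conditional operator, the `BC` and `B` terms the other.
  have hexp : ρ * (hAB ρ + hBC ρ - hB ρ - hABC ρ) =
      (ρ * logm ρ - ρ * (logm (rhoAB ρ) ⊗ₖ (1 : Matrix C C ℂ))) -
      (ρ * Matrix.reindex (Equiv.prodAssoc A B C).symm (Equiv.prodAssoc A B C).symm
        ((1 : Matrix A A ℂ) ⊗ₖ logm (rhoBC ρ)) -
       ρ * Matrix.reindex (Equiv.prodAssoc A B C).symm (Equiv.prodAssoc A B C).symm
        ((1 : Matrix A A ℂ) ⊗ₖ (logm (rhoB ρ) ⊗ₖ (1 : Matrix C C ℂ)))) := by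
    rw [← hassoc, hAB, hBC, hB, hABC]
    simp only [← mul_sub]
    congr 1
    abel
  rw [ssaOperator, hexp, hL, hL, hL, traceLeft_mul_one_kronecker, traceLeft_mul_one_kronecker,
    condOperator, condOperator, traceRight_rhoBC, rhoAB]

/-- Tracing out `A` decreases the conditional operator: a competitor for `ρ_BC` is lifted to one for
`ρ` by tensoring with the identity on `A`. -/
theorem posSemidef_condOperator_sub {ρ : Matrix ((A × B) × C) ((A × B) × C) ℂ}
    (hρ : ρ.PosSemidef) : (condOperator ρ - condOperator (rhoBC ρ)).PosSemidef := by
  have hBC := posSemidef_rhoBC hρ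
  have hH := (isHermitian_condOperator hρ.isHermitian).sub (isHermitian_condOperator hBC.isHermitian)
  refine Matrix.PosSemidef.of_dotProduct_mulVec_nonneg hH fun c => ?_
  have hmono := trace_relEntropy_mono hρ (posSemidef_traceRight hρ) hBC
    (posSemidef_traceRight hBC) (idKet (A × B) c) (idKet B c)
    (mulVec_idKet_mulVec_eq_zero hρ c) (mulVec_idKet_mulVec_eq_zero hBC c)
    (by rw [← liftLeft_idKet, trace_conjTranspose_liftLeft_mul])
    (fun Y => ⟨liftLeft A Y, by
      rw [← liftLeft_idKet, ← liftLeft_sub, trace_conjTranspose_liftLeft_mul], by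
      rw [trace_conjTranspose_liftLeft_mul_self, traceRight_rhoBC, rhoB]⟩)
  rw [Complex.nonneg_iff]
  constructor
  · rw [Matrix.sub_mulVec, dotProduct_sub, dotProduct_condOperator_mulVec,
      dotProduct_condOperator_mulVec]
    simpa using hmono
  · exact (hH.im_star_dotProduct_mulVec_self c).symm

end CondOperator

end OperatorSSA

theorem theorem2 {A B C : Type*} [Fintype A] [DecidableEq A] [Fintype B] [DecidableEq B]
    [Fintype C] [DecidableEq C] (ρ : Matrix ((A × B) × C) ((A × B) × C) ℂ)
    (hρ : OperatorSSA.IsDensityMatrix ρ) :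
    (OperatorSSA.ssaOperator ρ).PosSemidef ∧
    (OperatorSSA.ssaOperator ρ).trace =
      ((OperatorSSA.entropy (OperatorSSA.rhoAB ρ) + OperatorSSA.entropy (OperatorSSA.rhoBC ρ)
        - OperatorSSA.entropy (OperatorSSA.rhoB ρ) - OperatorSSA.entropy ρ : ℝ) : ℂ) ∧
    OperatorSSA.entropy (OperatorSSA.rhoB ρ) + OperatorSSA.entropy ρ ≤
      OperatorSSA.entropy (OperatorSSA.rhoAB ρ) + OperatorSSA.entropy (OperatorSSA.rhoBC ρ) := by
  have hpos : (OperatorSSA.ssaOperator ρ).PosSemidef := by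
    rw [OperatorSSA.ssaOperator_eq_condOperator_sub]
    exact OperatorSSA.posSemidef_condOperator_sub hρ.posSemidef
  have htrace : (OperatorSSA.ssaOperator ρ).trace =
      ((OperatorSSA.entropy (OperatorSSA.rhoAB ρ) + OperatorSSA.entropy (OperatorSSA.rhoBC ρ)
        - OperatorSSA.entropy (OperatorSSA.rhoB ρ) - OperatorSSA.entropy ρ : ℝ) : ℂ) := by
    rw [OperatorSSA.ssaOperator_eq_condOperator_sub, Matrix.trace_sub,
      OperatorSSA.trace_condOperator hρ.posSemidef,
      OperatorSSA.trace_condOperator (OperatorSSA.posSemidef_rhoBC hρ.posSemidef),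
      OperatorSSA.traceRight_rhoBC, OperatorSSA.rhoAB]
    push_cast
    ring
  refine ⟨hpos, htrace, ?_⟩
  have h := hpos.trace_nonneg
  rw [htrace, Complex.zero_le_real] at h
  linarith
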